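/- Let $n, m \ge 1$ be integers. Consider $n$ balls labelled $1, \dots, n$ and $m+1$ urns labelled $0, 1, \dots, m$, and the following Markov chain on the configurations $\{0,1,\dots,m\}^n$ of balls in urns: at each step, choose a ball and an urn uniformly and independently, and place that ball in that urn. This chain has a unique invariant distribution $\pi_{n,m}$. For an integer $t \ge 0$ write $d_{\mathrm{TV}}^{n,m}(t) = \tfrac12 \sum_y |P_{n,m}^t(\bar x, y) - \pi_{n,m}(y)|$, where $P_{n,m}$ is the transition matrix of the chain and $\bar x = (0, \dots, 0)$ is the configuration with all $n$ balls in urn $0$; that is, the total variation distance of the chain after $t$ steps, started from $\bar x$, from its invariant distribution. Let $(n_N)_{N \in \mathbb N}$ and $(m_N)_{N \in \mathbb N}$ be sequences of positive integers with $\lim_{N\to\infty} m_N / n_N = 0$. Then, for every $c \in \mathbb R$, $$ d_{\mathrm{TV}}^{n_N, m_N}\bigl( \tfrac12 n_N \log(m_N n_N) + c\, n_N \bigr) \longrightarrow 2\,\Phi\bigl( \tfrac12 e^{-c} \bigr) - 1 \qquad \text{as } N \to \infty, $$ where $\Phi$ is the distribution function of the standard normal law, and where the time may be rounded to an integer either down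 or up (a negative time, which occurs for at most finitely many $N$, is read as $0$). -/

import Mathlib

open Filter Topology ProbabilityTheory

noncomputable section

/-- Configurations of `n` labelled balls in the `m + 1` urns labelled `0, …, m`:
`x j` is the urn that contains ball `j`. -/
abbrev UrnConfig (n m : ℕ) : Type := Fin n → Fin (m + 1)

/-- Transition matrix of the Ehrenfest chain: the entry at `(x, y)` is the probability that a
uniform ball `j` and an independent uniform urn `u` are such that `y` is obtained from `x` by
placing ball `j` in urn `u`. -/
def ehrenfestMatrix (n m : ℕ) : Matrix (UrnConfig n m) (UrnConfig n m) ℝ :=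
  fun x y => ∑ j : Fin n, ∑ u : Fin (m + 1),
    if Function.update x j u = y then 1 / (n : ℝ) * (1 / ((m : ℝ) + 1)) else 0

/-- The initial configuration: all balls are in urn `0`. -/
def allInUrnZero (n m : ℕ) : UrnConfig n m := fun _ => 0

/-- `π` is an invariant probability distribution of the transition matrix `P`. -/
structure IsInvariantDistribution {Ω : Type*} [Fintype Ω] (P : Matrix Ω Ω ℝ) (π : Ω → ℝ) :
    Prop where
  nonneg : ∀ x, 0 ≤ π x
  sum_eq_one : ∑ x, π x = 1
  invariant : ∀ y, ∑ x, π x * P x y = π y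

/-- Total variation distance between two distributions on a finite set. -/
def tvDist {Ω : Type*} [Fintype Ω] (μ ν : Ω → ℝ) : ℝ := (1 / 2) * ∑ x, |μ x - ν x|

/-- Total variation distance from `π` of the Ehrenfest chain after `t` steps, started with all
balls in urn `0`. -/
def ehrenfestTV (n m : ℕ) (π : UrnConfig n m → ℝ) (t : ℕ) : ℝ :=
  tvDist (fun y => (ehrenfestMatrix n m ^ t) (allInUrnZero n m) y) π

/-- The distribution function of the standard normal law. -/
def stdNormalCDF (x : ℝ) : ℝ := cdf (gaussianReal 0 1) x

end

/-! The products of `urnScore` over sets `S` of balls are orthogonal left eigenvectors of the chain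
with eigenvalues `1 - |S|/n`, and the point mass at the start is a multiple of their sum. So the
density at time `t` relative to the uniform law is the sum over `S` of `(1 - |S|/n)^t * urnChar S`
(`ehrenfestMatrix_pow_apply`).

Replacing `(1 - |S|/n)^t` by `s^|S|`, where `s = exp (-t/n)`, turns this into the product density
`urnLikelihood s`, as if the balls were refreshed at independent exponential times. By orthogonality
the squared `L²` error is at most `t/n² * exp (4 n m s²)`, which vanishes at the cutoff time
(`abs_ehrenfestTV_sub_le`).

Under the uniform law the logarithm of the product density is an i.i.d. sum. Here `n m s²` tends to
`a²` with `a = exp (-c)`, and `m/n → 0` forces `s m → 0`, so the summands are uniformly small and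
the sum converges to `N(-a²/2, a²)` (`tendsto_urnLogLaw`). The total variation distance is the mean
of the bounded function `max (1 - exp x) 0`, whose Gaussian integral is `2 Φ(a/2) - 1`. -/

/-! ### Spectral decomposition and the invariant law -/

/-- The centred indicator `(m + 1) 1_{u = 0} - 1` of urn `0`. -/
def urnScore (m : ℕ) (u : Fin (m + 1)) : ℝ := if u = 0 then (m : ℝ) else -1

lemma sum_urnScore_comp (m : ℕ) {E : Type*} [AddCommMonoid E] (f : ℝ → E) :
    ∑ u, f (urnScore m u) = f m + m • f (-1) := by
  rw [Fin.sum_univ_succ]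
  simp [urnScore, Fin.succ_ne_zero]

lemma sum_urnScore (m : ℕ) : ∑ u, urnScore m u = 0 := by
  have := sum_urnScore_comp m (fun x => x)
  simp at this; exact this

lemma sum_urnScore_sq (m : ℕ) : ∑ u, urnScore m u ^ 2 = ((m : ℝ) + 1) * m := by
  have := sum_urnScore_comp m (fun x => x ^ 2)
  simp at this; rw [this]; ring

lemma sum_mul_ehrenfestMatrix {n m : ℕ} (g : UrnConfig n m → ℝ) (y : UrnConfig n m) :
    ∑ z, g z * ehrenfestMatrix n m z y =
      1 / (n : ℝ) * (1 / ((m : ℝ) + 1)) * ∑ j, ∑ v, g (Function.update y j v) := by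
  have key : ∀ j : Fin n, ∑ z, ∑ u : Fin (m + 1),
      (if Function.update z j u = y then g z else 0) = ∑ v, g (Function.update y j v) := by
    intro j
    rw [← Finset.sum_product']
    rw [← Finset.sum_filter]
    -- A pair `(z, u)` leading to `y` has `u = y j`, so it is determined by the old urn `z j`.
    refine Finset.sum_bij' (fun p _ => p.1 j) (fun v _ => (Function.update y j v, y j))
      ?_ ?_ ?_ ?_ ?_
    · simp
    · simp
    · rintro ⟨z, u⟩ h
      simp only [Finset.mem_filter] at h
      simp [← h.2]
    · simp
    · rintro ⟨z, u⟩ h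
      simp only [Finset.mem_filter] at h
      simp [← h.2]
  simp_rw [ehrenfestMatrix, Finset.mul_sum]
  rw [Finset.sum_comm]
  refine Finset.sum_congr rfl fun j _ => ?_
  rw [← Finset.mul_sum, ← key j, Finset.mul_sum]
  refine Finset.sum_congr rfl fun z _ => ?_
  rw [Finset.mul_sum]
  refine Finset.sum_congr rfl fun u _ => ?_
  split_ifs <;> ring

/-- The character `∏_{i ∈ S} urnScore (y i)` indexed by a set `S` of balls. -/
def urnChar {n m : ℕ} (S : Finset (Fin n)) (y : UrnConfig n m) : ℝ := ∏ i ∈ S, urnScore m (y i)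

lemma sum_urnChar_update {n m : ℕ} (S : Finset (Fin n)) (y : UrnConfig n m) (j : Fin n) :
    ∑ v, urnChar S (Function.update y j v) = if j ∈ S then 0 else ((m : ℝ) + 1) * urnChar S y := by
  split_ifs with h
  · have : ∀ v, urnChar S (Function.update y j v) = urnScore m v * urnChar (S.erase j) y := by
      intro v
      rw [urnChar, ← Finset.mul_prod_erase _ _ h]
      simp only [Function.update_self, urnChar]
      congr 1
      refine Finset.prod_congr rfl fun i hi => ?_
      rw [Function.update_of_ne (Finset.ne_of_mem_erase hi)]
    simp_rw [this, ← Finset.sum_mul, sum_urnScore, zero_mul]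
  · have : ∀ v, urnChar S (Function.update y j v) = urnChar S y := by
      intro v
      refine Finset.prod_congr rfl fun i hi => ?_
      rw [Function.update_of_ne (fun e : i = j => h (e ▸ hi))]
    simp [this]

/-- Resampling ball `j` averages its score to zero if `j ∈ S` and leaves the character unchanged
otherwise. -/
lemma sum_urnChar_mul_ehrenfestMatrix {n m : ℕ} (hn : 1 ≤ n) (S : Finset (Fin n))
    (y : UrnConfig n m) :
    ∑ z, urnChar S z * ehrenfestMatrix n m z y = (1 - (S.card : ℝ) / n) * urnChar S y := by
  rw [sum_mul_ehrenfestMatrix]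
  simp_rw [sum_urnChar_update]
  have h1 : ∑ j : Fin n, (if j ∈ S then (0 : ℝ) else ((m : ℝ) + 1) * urnChar S y) =
      ((n : ℝ) - S.card) * (((m : ℝ) + 1) * urnChar S y) := by
    have : ∀ j : Fin n, (if j ∈ S then (0 : ℝ) else ((m : ℝ) + 1) * urnChar S y) =
      ((m : ℝ) + 1) * urnChar S y - if j ∈ S then ((m : ℝ) + 1) * urnChar S y else 0 := by
      intro j; split_ifs <;> simp
    simp_rw [this, Finset.sum_sub_distrib]
    simp
    ring
  rw [h1]
  have : (n : ℝ) ≠ 0 := by positivity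
  have : (m : ℝ) + 1 ≠ 0 := by positivity
  field_simp

lemma sum_urnChar_eq_prod {n m : ℕ} (s : ℝ) (y : UrnConfig n m) :
    ∑ S : Finset (Fin n), s ^ S.card * urnChar S y = ∏ i, (1 + s * urnScore m (y i)) := by
  rw [Finset.prod_one_add, Finset.powerset_univ]
  simp_rw [urnChar, Finset.prod_mul_distrib, Finset.prod_const]

lemma ehrenfestMatrix_pow_apply {n m : ℕ} (hn : 1 ≤ n) (t : ℕ) (y : UrnConfig n m) :
    (ehrenfestMatrix n m ^ t) (allInUrnZero n m) y = (((m : ℝ) + 1) ^ n)⁻¹ *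
      ∑ S : Finset (Fin n), (1 - (S.card : ℝ) / n) ^ t * urnChar S y := by
  induction t generalizing y with
  | zero =>
    -- At time `0` the sum is `∏ (1 + urnScore)`; each factor is `m + 1` in urn `0` and `0`
    -- elsewhere.
    have := sum_urnChar_eq_prod 1 y
    simp only [one_pow, one_mul] at this
    simp only [pow_zero, one_mul, this, Matrix.one_apply]
    have hp : (((m : ℝ) + 1) ^ n) ≠ 0 := by positivity
    split_ifs with h
    · subst h
      simp [allInUrnZero, urnScore]
      rw [add_comm (1 : ℝ), inv_mul_cancel₀ hp]
    · have : ∃ i, y i ≠ 0 := by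
        by_contra! h'
        exact h (funext fun i => (h' i).symm)
      obtain ⟨i, hi⟩ := this
      rw [Finset.prod_eq_zero (Finset.mem_univ i), mul_zero]
      simp [urnScore, hi]
  | succ t ih =>
    rw [pow_succ, Matrix.mul_apply]
    simp_rw [ih, Finset.mul_sum, Finset.sum_mul]
    rw [Finset.sum_comm]
    refine Finset.sum_congr rfl fun S _ => ?_
    rw [pow_succ, mul_assoc ((1 - (S.card : ℝ) / n) ^ t), ← sum_urnChar_mul_ehrenfestMatrix hn,
      Finset.mul_sum, Finset.mul_sum]
    refine Finset.sum_congr rfl fun z _ => ?_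
    ring

lemma isInvariantDistribution_uniform {n m : ℕ} (hn : 1 ≤ n) :
    IsInvariantDistribution (ehrenfestMatrix n m) (fun _ => (((m : ℝ) + 1) ^ n)⁻¹) where
  nonneg _ := by positivity
  sum_eq_one := by
    have hp : (((m : ℝ) + 1) ^ n) ≠ 0 := by positivity
    simp [hp]
  invariant y := by
    have := sum_urnChar_mul_ehrenfestMatrix (m := m) hn ∅ y
    simp [urnChar] at this
    rw [← Finset.mul_sum, this, mul_one]

/-- Maximum principle: at a maximiser, invariance equates `π` with an average over single-ball
changes, so these are maximisers too. Changing balls one at a time reaches every configuration. -/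
lemma IsInvariantDistribution.eq_uniform {n m : ℕ} (hn : 1 ≤ n) {π : UrnConfig n m → ℝ}
    (h : IsInvariantDistribution (ehrenfestMatrix n m) π) :
    π = fun _ => (((m : ℝ) + 1) ^ n)⁻¹ := by
  obtain ⟨y₀, -, hy₀⟩ := Finset.exists_max_image Finset.univ π Finset.univ_nonempty
  have hstep : ∀ y, π y = π y₀ → ∀ j v, π (Function.update y j v) = π y₀ := by
    intro y hy
    have h1 := h.invariant y
    rw [sum_mul_ehrenfestMatrix, hy] at h1
    have hn0 : (n : ℝ) ≠ 0 := by positivity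
    have hm0 : (m : ℝ) + 1 ≠ 0 := by positivity
    have h2 : ∑ j, ∑ v, π (Function.update y j v) = ∑ j : Fin n, ∑ v : Fin (m + 1), π y₀ := by
      simp
      field_simp at h1
      linarith
    simp_rw [← Finset.sum_product'] at h2
    have h3 := (Finset.sum_eq_sum_iff_of_le (fun p _ => hy₀ _ (Finset.mem_univ _))).1 h2
    intro j v
    exact h3 (j, v) (by simp)
  have hall : ∀ z, π z = π y₀ := by
    intro z
    have : ∀ s : Finset (Fin n), π (s.piecewise z y₀) = π y₀ := by
      intro s
      induction s using Finset.induction_on with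
      | empty => simp
      | insert a s _ ih =>
        rw [Finset.piecewise_insert]
        exact hstep _ ih _ _
    simpa using this Finset.univ
  have hs := h.sum_eq_one
  simp_rw [hall] at hs
  simp at hs
  funext z
  rw [hall z]
  exact eq_inv_of_mul_eq_one_right hs

/-! ### `L²` comparison with the product law -/

lemma sum_urnChar_mul_urnChar {n m : ℕ} (S T : Finset (Fin n)) :
    ∑ y : UrnConfig n m, urnChar S y * urnChar T y =
      if S = T then ((m : ℝ) + 1) ^ n * (m : ℝ) ^ S.card else 0 := by
  have h1 : ∀ y : UrnConfig n m, urnChar S y * urnChar T y =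
      ∏ i, ((if i ∈ S then urnScore m (y i) else 1) * if i ∈ T then urnScore m (y i) else 1) := by
    intro y
    rw [Finset.prod_mul_distrib]
    simp [urnChar, Finset.prod_ite_mem]
  simp_rw [h1]
  rw [← Fintype.prod_sum
    (f := fun i u => (if i ∈ S then urnScore m u else 1) * if i ∈ T then urnScore m u else 1)]
  split_ifs with h
  · subst h
    have : ∀ i : Fin n, ∑ u, ((if i ∈ S then urnScore m u else 1) *
        if i ∈ S then urnScore m u else 1) = ((m : ℝ) + 1) * if i ∈ S then (m : ℝ) else 1 := by
      intro i
      split_ifs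
      · rw [← sum_urnScore_sq]; simp_rw [sq]
      · simp
    simp_rw [this, Finset.prod_mul_distrib]
    simp [Finset.prod_ite_mem]
  · have : ∃ i, ¬ (i ∈ S ↔ i ∈ T) := by
      by_contra! h'
      exact h (Finset.ext h')
    obtain ⟨i, hi⟩ := this
    refine Finset.prod_eq_zero (Finset.mem_univ i) ?_
    by_cases hS : i ∈ S <;> by_cases hT : i ∈ T <;> simp_all [sum_urnScore]

lemma sum_sq_sum_urnChar {n m : ℕ} (c : Finset (Fin n) → ℝ) :
    ∑ y : UrnConfig n m, (∑ S, c S * urnChar S y) ^ 2 =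
      ((m : ℝ) + 1) ^ n * ∑ S, c S ^ 2 * (m : ℝ) ^ S.card := by
  simp_rw [sq, Finset.sum_mul_sum]
  rw [Finset.sum_comm, Finset.mul_sum]
  refine Finset.sum_congr rfl fun S _ => ?_
  rw [Finset.sum_comm]
  have : ∀ T, ∑ y : UrnConfig n m, c S * urnChar S y * (c T * urnChar T y) =
      if S = T then c S * c T * (((m : ℝ) + 1) ^ n * (m : ℝ) ^ S.card) else 0 := by
    intro T
    have h := sum_urnChar_mul_urnChar (m := m) S T
    calc _ = c S * c T * ∑ y : UrnConfig n m, urnChar S y * urnChar T y := by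
          rw [Finset.mul_sum]; exact Finset.sum_congr rfl fun y _ => by ring
      _ = _ := by rw [h]; split_ifs <;> simp
  simp_rw [this]
  simp
  ring

/-- With `x = j/n`, the ratio `r = ((1 - x) e^x)^t` of the two powers lies in `[1 - t x², 1]`, so
`(r - 1)² ≤ 1 - r ≤ t x²`. The bound `j² ≤ 4^j` makes the result geometric in `j`, so that the sum
over sets is binomial. -/
lemma sq_one_sub_div_pow_sub_exp_le {n : ℕ} (hn : 1 ≤ n) (t j : ℕ) (hj : j ≤ n) :
    ((1 - (j : ℝ) / n) ^ t - Real.exp (-(t / n : ℝ)) ^ j) ^ 2 ≤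
      (t : ℝ) / n ^ 2 * (4 * Real.exp (-(t / n : ℝ)) ^ 2) ^ j := by
  have hn0 : (0 : ℝ) < n := by positivity
  set x : ℝ := (j : ℝ) / n with hx
  have hx0 : 0 ≤ x := by positivity
  have hx1 : x ≤ 1 := by rw [hx, div_le_one hn0]; exact_mod_cast hj
  set r : ℝ := ((1 - x) * Real.exp x) ^ t with hr
  have hs : Real.exp (-(t / n : ℝ)) ^ j = Real.exp (-x) ^ t := by
    rw [← Real.exp_nat_mul, ← Real.exp_nat_mul, hx]; congr 1; field_simp
  have hb0 : 0 ≤ (1 - x) * Real.exp x := mul_nonneg (by linarith) (Real.exp_pos _).le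
  have hb1 : (1 - x) * Real.exp x ≤ 1 := by
    have h1 : 1 - x ≤ Real.exp (-x) := by linarith [Real.add_one_le_exp (-x)]
    calc (1 - x) * Real.exp x ≤ Real.exp (-x) * Real.exp x := by gcongr
      _ = 1 := by rw [← Real.exp_add]; simp
  have hb2 : 1 - x ^ 2 ≤ (1 - x) * Real.exp x := by
    calc 1 - x ^ 2 = (1 - x) * (x + 1) := by ring
      _ ≤ _ := mul_le_mul_of_nonneg_left (Real.add_one_le_exp x) (by linarith)
  have hr0 : 0 ≤ r := pow_nonneg hb0 _
  have hr1 : r ≤ 1 := pow_le_one₀ hb0 hb1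
  have hr2 : 1 - t * x ^ 2 ≤ r := by
    have h1 := one_add_mul_le_pow (a := -x ^ 2) (by nlinarith) t
    have h2 : (1 + -x ^ 2) ^ t ≤ r := pow_le_pow_left₀ (by nlinarith) (by linarith) t
    linarith
  have hd : (1 - x) ^ t - Real.exp (-(t / n : ℝ)) ^ j = Real.exp (-(t / n : ℝ)) ^ j * (r - 1) := by
    rw [hs, hr, mul_pow, mul_sub, mul_left_comm, ← mul_pow, ← Real.exp_add]; simp
  have hj2 : (j : ℝ) ^ 2 ≤ 4 ^ j := by
    have : (j : ℝ) ≤ 2 ^ j := by exact_mod_cast j.lt_two_pow_self.le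
    calc (j : ℝ) ^ 2 ≤ (2 ^ j) ^ 2 := by gcongr
      _ = 4 ^ j := by rw [← pow_mul, mul_comm, pow_mul]; norm_num
  rw [hd, mul_pow, mul_pow, ← pow_mul, ← pow_mul, mul_comm j 2]
  have h3 : (r - 1) ^ 2 ≤ (t : ℝ) / n ^ 2 * 4 ^ j := by
    calc (r - 1) ^ 2 ≤ t * x ^ 2 := by nlinarith
      _ = (t : ℝ) / n ^ 2 * (j : ℝ) ^ 2 := by rw [hx]; field_simp
      _ ≤ _ := by gcongr
  calc _ ≤ Real.exp (-(t / n : ℝ)) ^ (2 * j) * ((t : ℝ) / n ^ 2 * 4 ^ j) := by gcongr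
    _ = _ := by ring

/-- The likelihood ratio, with respect to the uniform law, of the law under which the balls are
independent and each of them is untouched (in urn `0`) with probability `s`, and uniform
otherwise. -/
def urnLikelihood {n m : ℕ} (s : ℝ) (y : UrnConfig n m) : ℝ := ∏ i, (1 + s * urnScore m (y i))

lemma sum_urnLikelihood {n m : ℕ} (s : ℝ) :
    ∑ y : UrnConfig n m, urnLikelihood s y = ((m : ℝ) + 1) ^ n := by
  simp_rw [urnLikelihood]
  rw [← Fintype.prod_sum (f := fun (_ : Fin n) u => 1 + s * urnScore m u)]
  simp_rw [Finset.sum_add_distrib, ← Finset.mul_sum, sum_urnScore]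
  simp

lemma sum_sq_density_sub_urnLikelihood_le {n m : ℕ} (hn : 1 ≤ n) (t : ℕ) :
    ∑ y : UrnConfig n m, (∑ S : Finset (Fin n), (1 - (S.card : ℝ) / n) ^ t * urnChar S y -
      urnLikelihood (Real.exp (-(t / n : ℝ))) y) ^ 2 ≤
    ((m : ℝ) + 1) ^ n * ((t : ℝ) / n ^ 2 *
      Real.exp (4 * (n * m * Real.exp (-(t / n : ℝ)) ^ 2))) := by
  set s := Real.exp (-(t / n : ℝ)) with hs
  simp_rw [urnLikelihood, ← sum_urnChar_eq_prod, ← Finset.sum_sub_distrib, ← sub_mul]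
  rw [sum_sq_sum_urnChar]
  gcongr
  calc _ ≤ ∑ S : Finset (Fin n), (t : ℝ) / n ^ 2 * (4 * s ^ 2 * m) ^ S.card := by
        refine Finset.sum_le_sum fun S _ => ?_
        rw [mul_pow _ (m : ℝ), ← mul_assoc]
        gcongr
        exact sq_one_sub_div_pow_sub_exp_le hn t S.card (by simpa using S.card_le_univ)
    _ = (t : ℝ) / n ^ 2 * (1 + 4 * s ^ 2 * m) ^ n := by
        rw [← Finset.mul_sum]
        congr 1
        have := Finset.prod_one_add (f := fun _ : Fin n => 4 * s ^ 2 * (m : ℝ)) Finset.univ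
        simp only [Finset.prod_const, Finset.powerset_univ] at this
        simpa using this.symm
    _ ≤ (t : ℝ) / n ^ 2 * Real.exp (4 * s ^ 2 * m) ^ n := by
        gcongr
        linarith [Real.add_one_le_exp (4 * s ^ 2 * (m : ℝ))]
    _ = _ := by
        rw [← Real.exp_nat_mul]; congr 2; ring

lemma abs_ehrenfestTV_sub_le {n m : ℕ} (hn : 1 ≤ n) (t : ℕ) :
    |ehrenfestTV n m (fun _ => (((m : ℝ) + 1) ^ n)⁻¹) t -
      (((m : ℝ) + 1) ^ n)⁻¹ * ∑ y : UrnConfig n m,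
        max (1 - urnLikelihood (Real.exp (-(t / n : ℝ))) y) 0| ≤
    √((t : ℝ) / n ^ 2 * Real.exp (4 * (n * m * Real.exp (-(t / n : ℝ)) ^ 2))) := by
  have hb := sum_sq_density_sub_urnLikelihood_le (m := m) hn t
  have hg1 := sum_urnLikelihood (n := n) (m := m) (Real.exp (-(t / n : ℝ)))
  set f : UrnConfig n m → ℝ := fun y =>
    ∑ S : Finset (Fin n), (1 - (S.card : ℝ) / n) ^ t * urnChar S y with hf
  set g : UrnConfig n m → ℝ := urnLikelihood (Real.exp (-(t / n : ℝ)))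
  set W : ℝ := ((m : ℝ) + 1) ^ n with hW
  set B : ℝ := (t : ℝ) / n ^ 2 * Real.exp (4 * (n * m * Real.exp (-(t / n : ℝ)) ^ 2))
  have hW0 : 0 < W := by positivity
  have hcard : ((Finset.univ : Finset (UrnConfig n m)).card : ℝ) = W := by simp [hW]
  have hTV : ehrenfestTV n m (fun _ => W⁻¹) t = (1 / 2) * (W⁻¹ * ∑ y, |f y - 1|) := by
    rw [ehrenfestTV, tvDist, Finset.mul_sum _ _ W⁻¹]
    congr 1
    refine Finset.sum_congr rfl fun y _ => ?_
    rw [ehrenfestMatrix_pow_apply hn, ← abs_of_pos (inv_pos.2 hW0), ← abs_mul,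
      abs_of_pos (inv_pos.2 hW0), mul_sub, mul_one]
  have hmax : W⁻¹ * ∑ y, max (1 - g y) 0 = (1 / 2) * (W⁻¹ * ∑ y, |g y - 1|) := by
    -- Since `g` has mean `1`, the first term averages out, leaving a bounded function of `log g`,
    -- suited to weak convergence.
    have h1 : ∀ y, |g y - 1| = (g y - 1) + 2 * max (1 - g y) 0 := by
      intro y
      rcases le_total (g y) 1 with h | h
      · rw [abs_of_nonpos (by linarith), max_eq_left (by linarith)]; ring
      · rw [abs_of_nonneg (by linarith), max_eq_right (by linarith)]; ring
    simp_rw [h1, Finset.sum_add_distrib, Finset.sum_sub_distrib, hg1, ← Finset.mul_sum]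
    rw [Finset.sum_const, nsmul_eq_mul, hcard]
    ring
  rw [hTV, hmax, ← mul_sub, ← mul_sub, ← Finset.sum_sub_distrib]
  have hcs : (∑ y, |f y - g y|) ^ 2 ≤ W * ∑ y, (f y - g y) ^ 2 := by
    have := sq_sum_le_card_mul_sum_sq (s := Finset.univ) (f := fun y => |f y - g y|)
    simpa only [hcard, sq_abs] using this
  have h2 : W⁻¹ * ∑ y, |f y - g y| ≤ √B := by
    refine Real.le_sqrt_of_sq_le ?_
    rw [mul_pow]
    calc W⁻¹ ^ 2 * (∑ y, |f y - g y|) ^ 2 ≤ W⁻¹ ^ 2 * (W * (W * B)) := by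
          gcongr; exact hcs.trans (by gcongr)
      _ = B := by field_simp
  have h3 : |∑ y, (|f y - 1| - |g y - 1|)| ≤ ∑ y, |f y - g y| := by
    refine (Finset.abs_sum_le_sum_abs _ _).trans (Finset.sum_le_sum fun y _ => ?_)
    have := abs_abs_sub_abs_le (f y - 1) (g y - 1)
    simpa using this
  rw [abs_mul, abs_mul, abs_of_pos (inv_pos.2 hW0), abs_of_pos (by norm_num : (0 : ℝ) < 1 / 2)]
  have h4 : W⁻¹ * |∑ y, (|f y - 1| - |g y - 1|)| ≤ W⁻¹ * ∑ y, |f y - g y| := by gcongr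
  have h5 : 0 ≤ W⁻¹ * |∑ y, (|f y - 1| - |g y - 1|)| := by positivity
  linarith

/-! ### Taylor expansions and limits of powers -/

open Asymptotics in
lemma log_one_add_isBigO : (fun x : ℝ => Real.log (1 + x) - (x - x ^ 2 / 2)) =O[𝓝 0]
    fun x => x ^ 3 := by
  refine IsBigO.of_bound 2 ?_
  filter_upwards [Metric.ball_mem_nhds (0 : ℝ) (by norm_num : (0 : ℝ) < 1 / 2)] with x hx
  rw [mem_ball_zero_iff, Real.norm_eq_abs] at hx
  have h := Real.abs_log_sub_add_sum_range_le (x := -x) (by rw [abs_neg]; linarith) 2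
  simp only [Finset.sum_range_succ, Finset.sum_range_zero, abs_neg, sub_neg_eq_add] at h
  rw [Real.norm_eq_abs, norm_pow, Real.norm_eq_abs]
  calc _ ≤ |x| ^ 3 / (1 - |x|) := by
        convert h using 2
        push_cast; ring
    _ ≤ |x| ^ 3 / (1 / 2) := by gcongr; linarith
    _ = _ := by ring

open Asymptotics in
lemma cexp_mul_log_one_add_isLittleO (w : ℂ) :
    (fun x : ℝ => Complex.exp (w * (Real.log (1 + x) : ℝ)) -
      (1 + w * x + w * (w - 1) / 2 * (x : ℂ) ^ 2)) =o[𝓝 0] fun x => x ^ 2 := by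
  have h32 : (fun x : ℝ => x ^ 3) =o[𝓝 0] fun x : ℝ => x ^ 2 := isLittleO_pow_pow (by norm_num)
  have h21 : (fun x : ℝ => x ^ 2) =o[𝓝 0] fun x : ℝ => x ^ 1 := isLittleO_pow_pow (by norm_num)
  simp only [pow_one] at h21
  have hL := log_one_add_isBigO
  have hL1 : (fun x : ℝ => Real.log (1 + x) - x) =O[𝓝 0] fun x => x ^ 2 := by
    have := (hL.trans h32.isBigO).sub ((isBigO_refl (fun x : ℝ => x ^ 2) (𝓝 0)).const_mul_left (1 / 2))
    exact this.congr_left fun x => by ring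
  have hL0 : (fun x : ℝ => Real.log (1 + x)) =O[𝓝 0] fun x => x :=
    ((hL1.trans h21.isBigO).add (isBigO_refl _ _)).congr_left fun x => by ring
  have hL2 : (fun x : ℝ => Real.log (1 + x) ^ 2 - x ^ 2) =o[𝓝 0] fun x => x ^ 2 := by
    have h := hL1.mul (hL0.add (isBigO_refl (fun x : ℝ => x) _))
    exact (h.congr (fun x => by ring) (fun x => by ring)).trans_isLittleO h32
  have hLc : (fun x : ℝ => ((Real.log (1 + x) : ℝ) : ℂ)) =O[𝓝 0] fun x => x := by
    rw [← isBigO_norm_left]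
    simpa only [Complex.norm_real] using hL0.norm_left
  have ht : Tendsto (fun x : ℝ => w * ((Real.log (1 + x) : ℝ) : ℂ)) (𝓝 0) (𝓝 0) := by
    have := (hLc.trans_tendsto tendsto_id).const_mul w
    simpa using this
  have h1 : (fun x : ℝ => Complex.exp (w * (Real.log (1 + x) : ℝ)) -
      (1 + w * (Real.log (1 + x) : ℝ) + (w * (Real.log (1 + x) : ℝ)) ^ 2 / 2)) =o[𝓝 0]
      fun x => x ^ 2 := by
    have h := ((Complex.exp_sub_sum_range_succ_isLittleO_pow 2).comp_tendsto ht)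
    have h' : (fun x : ℝ => (w * (Real.log (1 + x) : ℝ)) ^ 2) =O[𝓝 0] fun x => x ^ 2 :=
      (hLc.const_mul_left w).pow 2
    refine (h.trans_isBigO h').congr_left fun x => ?_
    simp [Finset.sum_range_succ]
  have h2 : (fun x : ℝ => (((Real.log (1 + x) - (x - x ^ 2 / 2) : ℝ)) : ℂ)) =o[𝓝 0]
      fun x => x ^ 2 := by
    rw [← isLittleO_norm_left]
    simpa only [Complex.norm_real] using (hL.trans_isLittleO h32).norm_left
  have h3 : (fun x : ℝ => ((Real.log (1 + x) ^ 2 - x ^ 2 : ℝ) : ℂ)) =o[𝓝 0]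
      fun x => x ^ 2 := by
    rw [← isLittleO_norm_left]
    simpa only [Complex.norm_real] using hL2.norm_left
  refine ((h1.add (h2.const_mul_left w)).add (h3.const_mul_left (w ^ 2 / 2))).congr_left
    fun x => ?_
  push_cast
  ring

open Asymptotics in
lemma tendsto_one_add_pow_of_tendsto_mul {k : ℕ → ℕ} {z : ℕ → ℂ} {ζ : ℂ}
    (hk : Tendsto k atTop atTop) (hz : Tendsto (fun N => (k N : ℂ) * z N) atTop (𝓝 ζ)) :
    Tendsto (fun N => (1 + z N) ^ k N) atTop (𝓝 (Complex.exp ζ)) := by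
  have hkinv : Tendsto (fun N => ((k N : ℂ))⁻¹) atTop (𝓝 0) :=
    (tendsto_inv_atTop_nhds_zero_nat (𝕜 := ℂ)).comp hk
  have hk0 : ∀ᶠ N in atTop, (k N : ℂ) ≠ 0 := by
    filter_upwards [hk.eventually_ge_atTop 1] with N hN
    exact Nat.cast_ne_zero.2 (by omega)
  have hz0 : Tendsto z atTop (𝓝 0) := by
    have := hkinv.mul hz
    rw [zero_mul] at this
    refine this.congr' ?_
    filter_upwards [hk0] with N hN
    field_simp
  have h1 : (fun N => (k N : ℂ) * (Complex.log (1 + z N) - z N)) =O[atTop]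
      fun N => ((k N : ℂ))⁻¹ * ((k N : ℂ) * z N) ^ 2 := by
    have := (isBigO_refl (fun N => (k N : ℂ)) atTop).mul
      (Complex.log_sub_self_isBigO.comp_tendsto hz0)
    refine this.congr' (Eventually.of_forall fun N => rfl) ?_
    filter_upwards [hk0] with N hN
    simp only [Function.comp]
    field_simp
  have h2 : Tendsto (fun N => ((k N : ℂ))⁻¹ * ((k N : ℂ) * z N) ^ 2) atTop (𝓝 0) := by
    simpa using hkinv.mul (hz.pow 2)
  have h3 : Tendsto (fun N => (k N : ℂ) * Complex.log (1 + z N)) atTop (𝓝 ζ) := by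
    have := (h1.trans_tendsto h2).add hz
    rw [zero_add] at this
    exact this.congr fun N => by ring
  refine ((Complex.continuous_exp.tendsto _).comp h3).congr' ?_
  have hne : ∀ᶠ N in atTop, 1 + z N ≠ 0 := by
    have : Tendsto (fun N => 1 + z N) atTop (𝓝 1) := by simpa using hz0.const_add 1
    exact this.eventually_ne one_ne_zero
  filter_upwards [hne] with N hN
  rw [Function.comp, Complex.exp_nat_mul, Complex.exp_log hN]

/-! ### Asymptotics of the characteristic function -/

/-- The characteristic function at `θ` of `log (1 + s * urnScore)` for a uniform urn. -/
noncomputable def urnLogCharFun (m : ℕ) (s θ : ℝ) : ℂ :=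
  ((m : ℂ) + 1)⁻¹ * ∑ u, Complex.exp (θ * Complex.I * (Real.log (1 + s * urnScore m u) : ℝ))

lemma abs_urnScore_le {m : ℕ} (hm : 1 ≤ m) (u : Fin (m + 1)) : |urnScore m u| ≤ m := by
  unfold urnScore
  split_ifs
  · simp
  · simpa using hm

-- The score has mean `0` and variance `m`, so the second-order expansion of `(1 + x)^(iθ)` gives `1
-- + β m s² + E`. The remainder bound applies to all urns at once because `|s * urnScore| ≤ s m →
-- 0`.
open Asymptotics in
lemma tendsto_urnLogCharFun_pow {n m : ℕ → ℕ} (hm : ∀ N, 1 ≤ m N) {s : ℕ → ℝ} {A : ℝ}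
    (hn : Tendsto n atTop atTop) (hsm : Tendsto (fun N => s N * m N) atTop (𝓝 0))
    (hA : Tendsto (fun N => (n N : ℝ) * m N * s N ^ 2) atTop (𝓝 A)) (θ : ℝ) :
    Tendsto (fun N => urnLogCharFun (m N) (s N) θ ^ n N) atTop
      (𝓝 (Complex.exp (A * (θ * Complex.I * (θ * Complex.I - 1) / 2)))) := by
  set w : ℂ := θ * Complex.I with hw
  set β : ℂ := w * (w - 1) / 2 with hβ
  set R : ℝ → ℂ := fun x => Complex.exp (w * (Real.log (1 + x) : ℝ)) -
      (1 + w * x + β * (x : ℂ) ^ 2) with hR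
  have hRo : R =o[𝓝 0] fun x => x ^ 2 := cexp_mul_log_one_add_isLittleO w
  set E : ℕ → ℂ := fun N => ((m N : ℂ) + 1)⁻¹ * ∑ u, R (s N * urnScore (m N) u) with hE
  have hexp : ∀ N, urnLogCharFun (m N) (s N) θ =
      1 + (β * ((m N * s N ^ 2 : ℝ) : ℂ) + E N) := by
    intro N
    have hm0 : (m N : ℂ) + 1 ≠ 0 := by exact_mod_cast (Nat.succ_ne_zero (m N))
    have h1 : ∀ u, Complex.exp (w * (Real.log (1 + s N * urnScore (m N) u) : ℝ)) =
        (1 + w * s N * (urnScore (m N) u : ℂ) + β * (s N : ℂ) ^ 2 * ((urnScore (m N) u ^ 2 : ℝ) : ℂ)) +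
          R (s N * urnScore (m N) u) := by
      intro u
      simp only [hR]
      push_cast
      ring
    have h2 : ∑ u, (urnScore (m N) u : ℂ) = 0 := by
      rw [← Complex.ofReal_sum, sum_urnScore]; simp
    have h3 : ∑ u, ((urnScore (m N) u ^ 2 : ℝ) : ℂ) = ((m N : ℂ) + 1) * m N := by
      rw [← Complex.ofReal_sum, sum_urnScore_sq]; simp
    simp only [urnLogCharFun, hE, ← hw]
    simp_rw [h1, Finset.sum_add_distrib, ← Finset.mul_sum, h2, h3]
    simp only [Finset.sum_const, Finset.card_univ, Fintype.card_fin, nsmul_eq_mul]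
    push_cast
    field_simp
    ring
  have hE0 : Tendsto (fun N => (n N : ℂ) * E N) atTop (𝓝 0) := by
    have hlo : (fun N => (n N : ℂ) * E N) =o[atTop] fun N => (n N : ℝ) * m N * s N ^ 2 := by
      rw [isLittleO_iff]
      intro ε hε
      obtain ⟨δ, hδ, hRδ⟩ := Metric.eventually_nhds_iff.1 (isLittleO_iff.1 hRo hε)
      filter_upwards [(Metric.tendsto_nhds.1 hsm) δ hδ] with N hN
      rw [Real.dist_eq, sub_zero, abs_mul, Nat.abs_cast] at hN
      have hb : ∀ u, ‖R (s N * urnScore (m N) u)‖ ≤ ε * (s N ^ 2 * urnScore (m N) u ^ 2) := by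
        intro u
        have := @hRδ (s N * urnScore (m N) u) (by
          rw [Real.dist_eq, sub_zero, abs_mul]
          refine lt_of_le_of_lt ?_ hN
          gcongr
          exact abs_urnScore_le (hm N) u)
        rwa [Real.norm_eq_abs, abs_of_nonneg (sq_nonneg _), mul_pow] at this
      have hsum : ‖∑ u, R (s N * urnScore (m N) u)‖ ≤ ε * (s N ^ 2 * (((m N : ℝ) + 1) * m N)) := by
        refine (norm_sum_le _ _).trans ((Finset.sum_le_sum fun u _ => hb u).trans_eq ?_)
        rw [← Finset.mul_sum, ← Finset.mul_sum, sum_urnScore_sq]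
      have hm0 : (0 : ℝ) < (m N : ℝ) + 1 := by positivity
      have hnorm : ‖((m N : ℂ) + 1)⁻¹‖ = ((m N : ℝ) + 1)⁻¹ := by
        rw [norm_inv]
        congr 1
        have := Complex.norm_natCast (m N + 1)
        push_cast at this
        exact this
      rw [norm_mul, hE, norm_mul, hnorm, Complex.norm_natCast, Real.norm_of_nonneg (by positivity)]
      calc _ ≤ (n N : ℝ) * (((m N : ℝ) + 1)⁻¹ * (ε * (s N ^ 2 * (((m N : ℝ) + 1) * m N)))) := by
            gcongr
        _ = _ := by field_simp
    have := hlo.trans_isBigO (hA.isBigO_one ℝ)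
    exact (isLittleO_one_iff ℝ).1 this
  simp_rw [hexp]
  refine tendsto_one_add_pow_of_tendsto_mul hn ?_
  have hAc : Tendsto (fun N => (((n N : ℝ) * m N * s N ^ 2 : ℝ) : ℂ)) atTop (𝓝 (A : ℂ)) :=
    (Complex.continuous_ofReal.tendsto _).comp hA
  have := (hAc.mul_const β).add hE0
  rw [add_zero] at this
  refine this.congr fun N => ?_
  push_cast
  ring

/-! ### Gaussian computations -/

section

open MeasureTheory

lemma stdNormalCDF_eq_real (x : ℝ) : stdNormalCDF x = (gaussianReal 0 1).real (Set.Iic x) := by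
  rw [stdNormalCDF, cdf_eq_real]

lemma stdNormalCDF_neg (x : ℝ) : stdNormalCDF (-x) = 1 - stdNormalCDF x := by
  have : NullSingletonClass (gaussianReal 0 1) := nullSingletonClass_gaussianReal one_ne_zero
  rw [stdNormalCDF_eq_real, stdNormalCDF_eq_real, ← probReal_compl_eq_one_sub measurableSet_Iic]
  have h := gaussianReal_map_neg (μ := 0) (v := 1)
  rw [neg_zero] at h
  conv_lhs => rw [← h]
  rw [map_measureReal_apply measurable_neg measurableSet_Iic]
  rw [Set.compl_Iic, show (fun y : ℝ => -y) ⁻¹' Set.Iic (-x) = Set.Ici x by ext; simp]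
  exact measureReal_congr Ioi_ae_eq_Ici.symm

lemma gaussianReal_real_Iic_zero {a : ℝ} (ha : 0 < a) (b : ℝ) :
    (gaussianReal (a * b) (NNReal.mk (a ^ 2) (sq_nonneg a))).real (Set.Iic 0) = stdNormalCDF (-b) := by
  have h1 : gaussianReal (a * b) (NNReal.mk (a ^ 2) (sq_nonneg a)) =
      (gaussianReal 0 1).map (fun x => a * (x + b)) := by
    rw [show (fun x => a * (x + b)) = (fun x => a * x) ∘ (fun x => x + b) from rfl,
      ← Measure.map_map (by fun_prop) (by fun_prop), gaussianReal_map_add_const,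
      gaussianReal_map_const_mul]
    congr 1
    · ring
    · rw [mul_one]
  rw [h1, map_measureReal_apply (by fun_prop) measurableSet_Iic, stdNormalCDF_eq_real]
  congr 1
  ext x
  simp only [Set.mem_preimage, Set.mem_Iic]
  rw [mul_nonpos_iff_pos_imp_nonpos]
  constructor
  · intro h; linarith [h.1 ha]
  · intro h; exact ⟨fun _ => by linarith, fun _ => ha.le⟩

/-- Multiplying the density of `N(-a²/2, a²)` by `e^x` gives that of `N(a²/2, a²)`, so the integral
is a difference of two Gaussian probabilities of `(-∞, 0]`. -/
lemma integral_max_one_sub_exp_gaussianReal {a : ℝ} (ha : 0 < a) :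
    ∫ x, max (1 - Real.exp x) 0 ∂(gaussianReal (-(a ^ 2 / 2)) (NNReal.mk (a ^ 2) (sq_nonneg a))) =
      2 * stdNormalCDF (a / 2) - 1 := by
  have hv : NNReal.mk (a ^ 2) (sq_nonneg a) ≠ 0 := by
    intro h; exact (pow_pos ha 2).ne' (congrArg NNReal.toReal h)
  set v : NNReal := (NNReal.mk (a ^ 2) (sq_nonneg a)) with hvd
  have hva : (v : ℝ) = a ^ 2 := rfl
  have h1 : ∀ x, gaussianPDFReal (-(a ^ 2 / 2)) v x • max (1 - Real.exp x) 0 =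
      (Set.Iic (0 : ℝ)).indicator
        (fun x => gaussianPDFReal (-(a ^ 2 / 2)) v x - gaussianPDFReal (a ^ 2 / 2) v x) x := by
    intro x
    by_cases hx : x ≤ 0
    · rw [Set.indicator_of_mem (by exact hx), max_eq_left (by simpa using hx), smul_eq_mul,
        mul_sub, mul_one]
      congr 1
      simp only [gaussianPDFReal, hva]
      rw [mul_assoc, ← Real.exp_add]
      congr 2
      field_simp
      ring
    · rw [Set.indicator_of_notMem (by exact hx), max_eq_right, smul_zero]
      have := Real.add_one_le_exp x
      linarith [not_le.1 hx]
  rw [integral_gaussianReal_eq_integral_smul hv]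
  simp_rw [h1]
  rw [integral_indicator measurableSet_Iic,
    integral_sub (integrable_gaussianPDFReal _ _).integrableOn
      (integrable_gaussianPDFReal _ _).integrableOn]
  have h2 : ∀ μ : ℝ, ∫ x in Set.Iic 0, gaussianPDFReal μ v x =
      (gaussianReal μ v).real (Set.Iic 0) := by
    intro μ
    rw [measureReal_def, gaussianReal_apply_eq_integral _ hv, ENNReal.toReal_ofReal]
    exact integral_nonneg fun x => gaussianPDFReal_nonneg _ _ _
  rw [h2, h2, show -(a ^ 2 / 2) = a * (-(a / 2)) by ring, show a ^ 2 / 2 = a * (a / 2) by ring,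
    gaussianReal_real_Iic_zero ha, gaussianReal_real_Iic_zero ha, neg_neg, stdNormalCDF_neg]
  ring

end

/-! ### Weak convergence of the log-likelihood -/

open MeasureTheory in
/-- The law of `∑ i, log (1 + s * urnScore m (y i))` for a uniform configuration `y`. -/
noncomputable def urnLogLaw (n m : ℕ) (s : ℝ) : ProbabilityMeasure ℝ :=
  ⟨(PMF.uniformOfFintype (UrnConfig n m)).toMeasure.map
      (fun y => ∑ i, Real.log (1 + s * urnScore m (y i))),
    Measure.isProbabilityMeasure_map (measurable_of_finite _).aemeasurable⟩

open MeasureTheory in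
lemma integral_urnLogLaw {E : Type*} [NormedAddCommGroup E] [NormedSpace ℝ E] [CompleteSpace E]
    [SecondCountableTopology E] (n m : ℕ) (s : ℝ) {F : ℝ → E} (hF : Continuous F) :
    ∫ x, F x ∂(urnLogLaw n m s : Measure ℝ) = (((m : ℝ) + 1) ^ n)⁻¹ •
      ∑ y : UrnConfig n m, F (∑ i, Real.log (1 + s * urnScore m (y i))) := by
  rw [urnLogLaw, ProbabilityMeasure.coe_mk, integral_map (measurable_of_finite _).aemeasurable
    hF.aestronglyMeasurable, PMF.integral_eq_sum, Finset.smul_sum]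
  refine Finset.sum_congr rfl fun y _ => ?_
  congr 1
  simp [ENNReal.toReal_add]

open MeasureTheory in
lemma charFun_urnLogLaw (n m : ℕ) (s θ : ℝ) :
    charFun (urnLogLaw n m s : Measure ℝ) θ = urnLogCharFun m s θ ^ n := by
  rw [charFun_apply_real, integral_urnLogLaw n m s (by fun_prop)]
  have h1 : ∀ y : UrnConfig n m, Complex.exp (θ * ((∑ i, Real.log (1 + s * urnScore m (y i)) : ℝ))
      * Complex.I) =
      ∏ i, Complex.exp (θ * Complex.I * (Real.log (1 + s * urnScore m (y i)) : ℝ)) := by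
    intro y
    rw [← Complex.exp_sum, ← Finset.mul_sum]
    congr 1
    push_cast
    ring
  simp_rw [h1]
  rw [← Fintype.prod_sum (f := fun (_ : Fin n) u =>
    Complex.exp (θ * Complex.I * (Real.log (1 + s * urnScore m u) : ℝ))), urnLogCharFun, mul_pow]
  simp

open MeasureTheory in
/-- The Gaussian law as an element of the space of probability measures. -/
noncomputable def gaussianProbabilityMeasure (μ : ℝ) (v : NNReal) : ProbabilityMeasure ℝ :=
  ⟨gaussianReal μ v, instIsProbabilityMeasureGaussianReal μ v⟩

open MeasureTheory in
lemma tendsto_urnLogLaw {n m : ℕ → ℕ} (hm : ∀ N, 1 ≤ m N) {s : ℕ → ℝ} {a : ℝ}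
    (hn : Tendsto n atTop atTop) (hsm : Tendsto (fun N => s N * m N) atTop (𝓝 0))
    (hA : Tendsto (fun N => (n N : ℝ) * m N * s N ^ 2) atTop (𝓝 (a ^ 2))) :
    Tendsto (fun N => urnLogLaw (n N) (m N) (s N)) atTop
      (𝓝 (gaussianProbabilityMeasure (-(a ^ 2 / 2)) (NNReal.mk (a ^ 2) (sq_nonneg a)))) := by
  rw [ProbabilityMeasure.tendsto_iff_tendsto_charFun]
  intro θ
  simp_rw [charFun_urnLogLaw]
  rw [gaussianProbabilityMeasure, ProbabilityMeasure.coe_mk, charFun_gaussianReal]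
  convert tendsto_urnLogCharFun_pow hm hn hsm hA θ using 3
  rw [show ((NNReal.mk (a ^ 2) (sq_nonneg a) : ℝ) : ℂ) = (a : ℂ) ^ 2 from Complex.ofReal_pow a 2]
  push_cast
  linear_combination (-(a : ℂ) ^ 2 * θ ^ 2 / 2) * Complex.I_sq

open MeasureTheory in
lemma integral_max_one_sub_exp_urnLogLaw {n m : ℕ} {s : ℝ} (hs0 : 0 ≤ s) (hs1 : s < 1) :
    ∫ x, max (1 - Real.exp x) 0 ∂(urnLogLaw n m s : Measure ℝ) =
      (((m : ℝ) + 1) ^ n)⁻¹ * ∑ y : UrnConfig n m, max (1 - urnLikelihood s y) 0 := by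
  rw [integral_urnLogLaw n m s (by fun_prop), smul_eq_mul]
  congr 1
  refine Finset.sum_congr rfl fun y _ => ?_
  -- Since `0 ≤ s < 1`, every factor `1 + s * urnScore` is positive, so `exp` undoes `log`.
  rw [Real.exp_sum, urnLikelihood]
  congr 2
  refine Finset.prod_congr rfl fun i _ => Real.exp_log ?_
  unfold urnScore
  split_ifs
  · positivity
  · linarith

open MeasureTheory in
lemma tendsto_sum_max_one_sub_urnLikelihood {n m : ℕ → ℕ} (hm : ∀ N, 1 ≤ m N) {s : ℕ → ℝ} {a : ℝ}
    (ha : 0 < a) (hs : ∀ N, 0 ≤ s N)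
    (hn : Tendsto n atTop atTop) (hsm : Tendsto (fun N => s N * m N) atTop (𝓝 0))
    (hA : Tendsto (fun N => (n N : ℝ) * m N * s N ^ 2) atTop (𝓝 (a ^ 2))) :
    Tendsto (fun N => (((m N : ℝ) + 1) ^ n N)⁻¹ *
      ∑ y : UrnConfig (n N) (m N), max (1 - urnLikelihood (s N) y) 0) atTop
      (𝓝 (2 * stdNormalCDF (a / 2) - 1)) := by
  have h := ProbabilityMeasure.tendsto_iff_forall_integral_tendsto.1
    (tendsto_urnLogLaw hm hn hsm hA)
    (BoundedContinuousFunction.ofNormedAddCommGroup (fun x => max (1 - Real.exp x) 0)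
      (by fun_prop) 1 (fun x => by
        rw [Real.norm_of_nonneg (le_max_right _ _)]
        exact max_le (by linarith [Real.exp_pos x]) zero_le_one))
  simp only [BoundedContinuousFunction.coe_ofNormedAddCommGroup, gaussianProbabilityMeasure,
    ProbabilityMeasure.coe_mk] at h
  rw [integral_max_one_sub_exp_gaussianReal ha] at h
  refine h.congr' ?_
  filter_upwards [hsm.eventually_lt_const one_pos] with N hN
  refine integral_max_one_sub_exp_urnLogLaw (hs N) (lt_of_le_of_lt ?_ hN)
  have : (1 : ℝ) ≤ m N := by exact_mod_cast hm N
  nlinarith [hs N]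

/-! ### Cutoff times and conclusion -/

lemma tendsto_atTop_of_tendsto_div {n m : ℕ → ℕ} (hn : ∀ N, 1 ≤ n N) (hm : ∀ N, 1 ≤ m N)
    (hmn : Tendsto (fun N => (m N : ℝ) / (n N : ℝ)) atTop (𝓝 0)) : Tendsto n atTop atTop := by
  rw [← tendsto_natCast_atTop_iff (R := ℝ)]
  have h1 : Tendsto (fun N => (m N : ℝ) / (n N : ℝ)) atTop (𝓝[>] 0) := by
    refine tendsto_nhdsWithin_iff.2 ⟨hmn, Eventually.of_forall fun N => ?_⟩
    have := hn N
    have := hm N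
    exact Set.mem_Ioi.2 (by positivity)
  refine tendsto_atTop_mono (fun N => ?_) (tendsto_inv_nhdsGT_zero.comp h1)
  have h2 : (1 : ℝ) ≤ m N := by exact_mod_cast hm N
  simp only [Function.comp, inv_div]
  exact div_le_self (by positivity) h2

lemma tendsto_log_mul_div {n m : ℕ → ℕ} (hn : ∀ N, 1 ≤ n N) (hm : ∀ N, 1 ≤ m N)
    (hmn : Tendsto (fun N => (m N : ℝ) / (n N : ℝ)) atTop (𝓝 0)) :
    Tendsto (fun N => Real.log ((m N : ℝ) * n N) / n N) atTop (𝓝 0) := by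
  have hnR : Tendsto (fun N => (n N : ℝ)) atTop atTop :=
    tendsto_natCast_atTop_atTop.comp (tendsto_atTop_of_tendsto_div hn hm hmn)
  have h1 : Tendsto (fun N => 2 * (Real.log (n N) / (n N : ℝ))) atTop (𝓝 0) := by
    have h := (Real.isLittleO_log_id_atTop.tendsto_div_nhds_zero).comp hnR
    simpa using h.const_mul 2
  refine squeeze_zero' (Eventually.of_forall fun N => ?_) ?_ h1
  · have h2 : (1 : ℝ) ≤ m N := by exact_mod_cast hm N
    have h3 : (1 : ℝ) ≤ n N := by exact_mod_cast hn N
    exact div_nonneg (Real.log_nonneg (one_le_mul_of_one_le_of_one_le h2 h3)) (by positivity)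
  -- Eventually `m ≤ n`, hence `log (m n) ≤ 2 log n`.
  · filter_upwards [hmn.eventually_le_const one_pos] with N hN
    have h2 : (0 : ℝ) < m N := by exact_mod_cast hm N
    have h3 : (0 : ℝ) < n N := by exact_mod_cast hn N
    rw [div_le_one h3] at hN
    rw [Real.log_mul h2.ne' h3.ne', ← mul_div_assoc, two_mul]
    gcongr

lemma tendsto_ehrenfestTV {n m : ℕ → ℕ} (hn : ∀ N, 1 ≤ n N) (hm : ∀ N, 1 ≤ m N)
    (hmn : Tendsto (fun N => (m N : ℝ) / (n N : ℝ)) atTop (𝓝 0)) {c : ℝ} {t : ℕ → ℕ}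
    (ht : Tendsto (fun N => (t N : ℝ) / n N - 1 / 2 * Real.log ((m N : ℝ) * n N)) atTop (𝓝 c)) :
    Tendsto (fun N => ehrenfestTV (n N) (m N) (fun _ => (((m N : ℝ) + 1) ^ n N)⁻¹) (t N)) atTop
      (𝓝 (2 * stdNormalCDF (1 / 2 * Real.exp (-c)) - 1)) := by
  have hnt := tendsto_atTop_of_tendsto_div hn hm hmn
  have hnR : Tendsto (fun N => (n N : ℝ)) atTop atTop := tendsto_natCast_atTop_atTop.comp hnt
  have hn0 : ∀ N, (0 : ℝ) < n N := fun N => by exact_mod_cast hn N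
  have hm0 : ∀ N, (0 : ℝ) < m N := fun N => by exact_mod_cast hm N
  have hA : Tendsto (fun N => (n N : ℝ) * m N * Real.exp (-((t N : ℝ) / n N)) ^ 2) atTop
      (𝓝 (Real.exp (-c) ^ 2)) := by
    have h := (Real.continuous_exp.tendsto _).comp ht.neg
    refine (h.pow 2).congr fun N => ?_
    simp only [Function.comp]
    rw [← Real.exp_nat_mul, ← Real.exp_nat_mul]
    rw [mul_comm (n N : ℝ)]
    conv_rhs => rw [← Real.exp_log (mul_pos (hm0 N) (hn0 N)), ← Real.exp_add]
    congr 1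
    push_cast
    ring
  have hsm : Tendsto (fun N => Real.exp (-((t N : ℝ) / n N)) * m N) atTop (𝓝 0) := by
    -- `(s m)² = (n m s²) (m/n)`: this is where `m/n → 0` makes the summands negligible.
    have h := (hA.mul hmn).sqrt
    rw [mul_zero, Real.sqrt_zero] at h
    refine h.congr fun N => ?_
    have := hn0 N
    rw [← Real.sqrt_sq (mul_pos (Real.exp_pos (-((t N : ℝ) / n N))) (hm0 N)).le]
    congr 1
    field_simp
  have ht2 : Tendsto (fun N => (t N : ℝ) / n N ^ 2) atTop (𝓝 0) := by
    have h := (ht.div_atTop hnR).add ((tendsto_log_mul_div hn hm hmn).const_mul (1 / 2))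
    rw [mul_zero, add_zero] at h
    refine h.congr fun N => ?_
    have := hn0 N
    field_simp
    ring
  have herr : Tendsto (fun N => √((t N : ℝ) / n N ^ 2 *
      Real.exp (4 * (n N * m N * Real.exp (-((t N : ℝ) / n N)) ^ 2)))) atTop (𝓝 0) := by
    have h := (ht2.mul ((Real.continuous_exp.tendsto _).comp (hA.const_mul 4))).sqrt
    rw [zero_mul, Real.sqrt_zero] at h
    exact h
  have hlim := tendsto_sum_max_one_sub_urnLikelihood hm (Real.exp_pos (-c))
    (fun N => (Real.exp_pos _).le) hnt hsm hA
  have hdiff := squeeze_zero_norm (fun N => (Real.norm_eq_abs _).trans_le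
    (abs_ehrenfestTV_sub_le (m := m N) (hn N) (t N))) herr
  have := hdiff.add hlim
  rw [zero_add, div_eq_inv_mul, ← one_div] at this
  exact this.congr fun N => by ring

lemma tendsto_div_sub_of_abs_sub_le_one {n t : ℕ → ℕ} (hn : Tendsto n atTop atTop) {l : ℕ → ℝ}
    {c : ℝ} (ht : ∀ᶠ N in atTop, |(t N : ℝ) - (1 / 2 * (n N : ℝ) * l N + c * n N)| ≤ 1) :
    Tendsto (fun N => (t N : ℝ) / n N - 1 / 2 * l N) atTop (𝓝 c) := by
  rw [tendsto_iff_norm_sub_tendsto_zero]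
  refine squeeze_zero' (Eventually.of_forall fun _ => norm_nonneg _) ?_
    (tendsto_inv_atTop_nhds_zero_nat (𝕜 := ℝ) |>.comp hn)
  filter_upwards [ht, hn.eventually_ge_atTop 1] with N hN h1
  have hn0 : (0 : ℝ) < n N := by exact_mod_cast h1
  have : (t N : ℝ) / n N - 1 / 2 * l N - c =
      ((t N : ℝ) - (1 / 2 * (n N : ℝ) * l N + c * n N)) * (n N : ℝ)⁻¹ := by
    field_simp
    ring
  rw [this, norm_mul, Real.norm_eq_abs, norm_inv, Real.norm_of_nonneg hn0.le]
  simpa using mul_le_mul_of_nonneg_right hN (inv_pos.2 hn0).le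

/-- `⌊·⌋₊` and `⌈·⌉₊` send negative reals to `0`, so they stay within `1` of the cutoff time only
once it is nonnegative, or nearly so. -/
lemma eventually_cutoff_time_nonneg {n m : ℕ → ℕ} (hn : ∀ N, 1 ≤ n N) (hm : ∀ N, 1 ≤ m N)
    (hmn : Tendsto (fun N => (m N : ℝ) / (n N : ℝ)) atTop (𝓝 0)) (c : ℝ) :
    ∀ᶠ N in atTop, 0 ≤ 1 / 2 * (n N : ℝ) * Real.log ((m N : ℝ) * n N) + c * n N := by
  have hnR : Tendsto (fun N => (n N : ℝ)) atTop atTop :=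
    tendsto_natCast_atTop_atTop.comp (tendsto_atTop_of_tendsto_div hn hm hmn)
  have hlog : Tendsto (fun N => Real.log ((m N : ℝ) * n N)) atTop atTop := by
    refine Real.tendsto_log_atTop.comp (tendsto_atTop_mono (fun N => ?_) hnR)
    have h2 : (1 : ℝ) ≤ m N := by exact_mod_cast hm N
    exact le_mul_of_one_le_left (by positivity) h2
  filter_upwards [hlog.eventually_ge_atTop (-2 * c)] with N hN
  have : 0 ≤ (n N : ℝ) * (1 / 2 * Real.log ((m N : ℝ) * n N) + c) :=
    mul_nonneg (by positivity) (by linarith)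
  linarith

theorem mainTheorem3 (n m : ℕ → ℕ) (hn : ∀ N, 1 ≤ n N) (hm : ∀ N, 1 ≤ m N)
    (hmn : Tendsto (fun N => (m N : ℝ) / (n N : ℝ)) atTop (𝓝 0)) :
    ∃ π : ∀ N, UrnConfig (n N) (m N) → ℝ,
      (∀ N, IsInvariantDistribution (ehrenfestMatrix (n N) (m N)) (π N) ∧
        ∀ π', IsInvariantDistribution (ehrenfestMatrix (n N) (m N)) π' → π' = π N) ∧
      ∀ c : ℝ,
        Tendsto (fun N => ehrenfestTV (n N) (m N) (π N)
            ⌊(1 / 2) * (n N : ℝ) * Real.log ((m N : ℝ) * (n N : ℝ)) + c * (n N : ℝ)⌋₊)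
          atTop (𝓝 (2 * stdNormalCDF ((1 / 2) * Real.exp (-c)) - 1)) ∧
        Tendsto (fun N => ehrenfestTV (n N) (m N) (π N)
            ⌈(1 / 2) * (n N : ℝ) * Real.log ((m N : ℝ) * (n N : ℝ)) + c * (n N : ℝ)⌉₊)
          atTop (𝓝 (2 * stdNormalCDF ((1 / 2) * Real.exp (-c)) - 1)) := by

  have hnt := tendsto_atTop_of_tendsto_div hn hm hmn
  refine ⟨fun N _ => (((m N : ℝ) + 1) ^ n N)⁻¹, fun N =>
    ⟨isInvariantDistribution_uniform (hn N), fun π' h => h.eq_uniform (hn N)⟩, fun c => ⟨?_, ?_⟩⟩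
  · refine tendsto_ehrenfestTV hn hm hmn (tendsto_div_sub_of_abs_sub_le_one hnt ?_)
    filter_upwards [eventually_cutoff_time_nonneg hn hm hmn c] with N hN
    rw [abs_le]
    constructor
    · linarith [Nat.lt_floor_add_one
        (1 / 2 * (n N : ℝ) * Real.log ((m N : ℝ) * n N) + c * n N)]
    · linarith [Nat.floor_le hN]
  · refine tendsto_ehrenfestTV hn hm hmn (tendsto_div_sub_of_abs_sub_le_one hnt ?_)
    filter_upwards [eventually_cutoff_time_nonneg hn hm hmn c] with N hN
    rw [abs_le]
    constructor
    · linarith [Nat.le_ceil (1 / 2 * (n N : ℝ) * Real.log ((m N : ℝ) * n N) + c * n N)]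
    · linarith [Nat.ceil_lt_add_one hN]
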